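/- **Setting.** Fix integers $N\ge 0$ (number of sources), $K\ge 0$, $T\ge 1$. The sources $n\in[N]=\{1,\dots,N\}$ are independent stationary two-state Markov chains $X_n(t)\in\{0,1\}$, $t=0,1,\dots,T$, with $\Pr(X_n(t+1)=1\mid X_n(t)=0)=\mu_n$ and $\Pr(X_n(t+1)=0\mid X_n(t)=1)=\lambda_n$, where $0<\mu_n,\lambda_n<\tfrac12$. Put $\zeta_n=\mu_n+\lambda_n$, so that $\Pr(X_n(0)=1)=\mu_n/\zeta_n$, and $\nu_n=\min(\lambda_n,\mu_n)$, $\omega_n=\max(\lambda_n,\mu_n)$. An update policy chooses, at each time $t\in[T]$ and for each source $n$, an indicator $U_n(t)\in\{0,1\}$, possibly at random, depending only on $X_n(0),\dots,X_n(t)$ and $U_n(1),\dots,U_n(t-1)$. The monitored value is $Y_n(t)=X_n(t-1)$ if $t\ge2$ and $U_n(t-1)=1$, and $Y_n(t)=Y_n(t-1)$ otherwise, with $Y_n(0)$ a given function of $X_n(0)$. The update rate of a policy is $\frac1T\sum_{t=1}^T\sum_{n=1}^N\mathbb E[U_n(t)]$. Let $\alpha_n=\Pr\big(\sum_{j<n}X_j(0)<K\big)$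 for $n\in[N]$, $\alpha_{N+1}=0$, $\beta_n(t)=\Pr(X_n(t)\ne Y_n(t))$, and $$\rho(t)=\min_{m\in[N+1]}\Big(\alpha_m+\sum_{n=1}^{m-1}\alpha_n\beta_n(t)\Big).$$ For nonnegative integers $T_1,\dots,T_N$, the policy with switching times $T_n$ sends an update of source $n$ at time $t$ exactly when: $t\le T_n$ and $X_n(t)\neq Y_n(t)$; or $t>T_n$, $\lambda_n\ge\mu_n$ and $(X_n(t),Y_n(t))=(0,1)$; or $t>T_n$, $\mu_n>\lambda_n$ and $(X_n(t),Y_n(t))=(1,0)$. For $\theta\in\mathbb R$ and $m\in[N+1]$ let $$\tau(\theta,m)=\alpha_m-\sum_{n=m}^{N}\frac{\nu_n}{\zeta_n}\min\big(\alpha_n,(\alpha_n+\theta)2\omega_n\big),\qquad \tilde{\mathcal N}(\theta)=\operatorname*{argmin}_{m\in[N+1]}\tau(\theta,m)$$ (the set of all minimizers; $\tau(\theta,N+1)=0$), and $$\mathcal A(\theta)=\Big\{n\in[N]:\theta<\alpha_n\big(\tfrac1{2\omega_n}-1\big),\ n<\min\tilde{\mathcal N}(\theta)\Big\},\qquad \mathcal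 B(\theta)=\Big\{n\in[N]:\theta\le\alpha_n\big(\tfrac1{2\omega_n}-1\big),\ n<\max\tilde{\mathcal N}(\theta)\Big\}.$$ **Theorem.** For every $\delta>0$ there is a constant $C$, depending only on $\delta$, such that the following holds for all $N,K,T$, all sources as above with $\zeta_n\ge\delta$ for every $n$, and all $r$ with $0<r\le\sum_{n=1}^N\frac{2\mu_n\lambda_n}{\zeta_n}$. There is a largest real number $\theta$ such that $$\sum_{n\in\mathcal A(\theta)}\frac{2\mu_n\lambda_n}{\zeta_n}\le r\le\sum_{n\in\mathcal B(\theta)}\frac{2\mu_n\lambda_n}{\zeta_n}.$$ For this $\theta$ put $$T_n=\begin{cases}T& n\in\mathcal A(\theta)\\ \lfloor T'\rfloor& n\in\mathcal B(\theta)\setminus\mathcal A(\theta)\\ 0&\text{otherwise,}\end{cases}\qquad T'=T\,\frac{r-\sum_{n\in\mathcal A(\theta)}2\mu_n\lambda_n/\zeta_n}{\sum_{n\in\mathcal B(\theta)\setminus\mathcal A(\theta)}2\mu_n\lambda_n/\zeta_n}.$$ Then the policy with switching times $T_n$, with its $\tilde\rho(t)$ (the quantity $\rho(t)$ computed for this policy),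 satisfies $$\frac1T\sum_{t=1}^T\tilde\rho(t)\le\frac1T\sum_{t=1}^T\rho(t)+C\,\frac NT$$ for the $\rho(t)$ of every update policy of update rate at most $r$ (in particular an optimal one), and its own update rate is at most $r+C\,\frac NT$. -/

import Mathlib

/- Time-slotted monitoring of binary remote sources.  A state or update indicator is a `Bool`:
`true` is "free" (1) for a state and "sends an update" (1) for an indicator.
Sources are indexed by `Fin N`; source `0` is the one of highest priority. -/

/-- A remote source: a two-state Markov chain with probability `mu` of passing from busy to free and
`lam` of passing from free to busy in one slot.  `init` is the initialization of the monitor: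
the monitored value at time `0` is `init (X 0)` (for instance `X 0` itself, or a constant). -/
structure RemoteSource where
  mu : ℝ
  lam : ℝ
  mu_pos : 0 < mu
  lam_pos : 0 < lam
  mu_lt : mu < 1 / 2
  lam_lt : lam < 1 / 2
  init : Bool → Bool

/-- The law on `{0, 1}` that gives mass `p` to `1`, for `p ∈ [0, 1]`. -/
noncomputable def coinLaw (p : ℝ) (h0 : 0 ≤ p) (h1 : p ≤ 1) : PMF Bool :=
  PMF.ofFintype (fun b => if b then ENNReal.ofReal p else ENNReal.ofReal (1 - p)) (by
    rw [Fintype.sum_bool]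
    simp only [if_true, Bool.false_eq_true, if_false]
    rw [← ENNReal.ofReal_add h0 (by linarith)]
    simp)

/-- The past of a source at time `t`: the list of the pairs (state, update indicator) at the times
`t - 1, t - 2, …, 0`, in this order.  Its length is `t`. -/
abbrev SourcePast := List (Bool × Bool)

/-- A causal, history dependent, possibly randomized update policy of one source: the conditional law
of the update indicator `U t`, given the present state `X t` and the past. -/
abbrev UpdatePolicy := Bool → SourcePast → PMF Bool

namespace RemoteSource

variable (s : RemoteSource)

noncomputable def zeta : ℝ := s.mu + s.lam

noncomputable def nu : ℝ := min s.lam s.mu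

noncomputable def omega : ℝ := max s.lam s.mu

/-- The rate `2 μ λ / ζ` of changes of state in the steady regime. -/
noncomputable def changeRate : ℝ := 2 * s.mu * s.lam / s.zeta

/-- The stationary law: free with probability `μ / ζ`. -/
noncomputable def stationary : PMF Bool :=
  coinLaw (s.mu / s.zeta)
    (div_nonneg s.mu_pos.le (add_pos s.mu_pos s.lam_pos).le)
    (div_le_one_of_le₀ (le_add_of_nonneg_right s.lam_pos.le) (add_pos s.mu_pos s.lam_pos).le)

/-- The law of the next state, given the present one. -/
noncomputable def step (x : Bool) : PMF Bool :=
  if x then coinLaw (1 - s.lam) (by linarith [s.lam_lt]) (by linarith [s.lam_pos])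
  else coinLaw s.mu s.mu_pos.le (by linarith [s.mu_lt])

/-- The monitored value `Y t`, given the present state and the past: `Y 0 = init (X 0)`, and `Y t` is
`X (t - 1)` if an update was sent at time `t - 1`, and `Y (t - 1)` otherwise. -/
def monitored : Bool → SourcePast → Bool
  | x, [] => s.init x
  | _, (x', u') :: h => if u' then x' else monitored x' h

/-- The law of the update indicator; no update is sent at time `0`. -/
noncomputable def updateLaw (U : UpdatePolicy) (x : Bool) (h : SourcePast) : PMF Bool :=
  if h = [] then PMF.pure false else U x h

/-- The joint law of the state at time `t` and of the past at time `t`, under a policy. -/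
noncomputable def law (U : UpdatePolicy) : ℕ → PMF (Bool × SourcePast)
  | 0 => s.stationary.map (fun x => (x, []))
  | t + 1 => (law U t).bind fun p =>
      (updateLaw U p.1 p.2).bind fun u =>
        (s.step p.1).map fun x' => (x', (p.1, u) :: p.2)

/-- `β(t)`, the probability that `X t ≠ Y t`. -/
noncomputable def errorProb (U : UpdatePolicy) (t : ℕ) : ℝ :=
  (((s.law U t).map fun p => p.1 != s.monitored p.1 p.2) true).toReal

/-- `𝔼[U t]`, that is, the probability that an update is sent at time `t`. -/
noncomputable def updateProb (U : UpdatePolicy) (t : ℕ) : ℝ :=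
  (((s.law U t).bind fun p => updateLaw U p.1 p.2) true).toReal

/-- The policy with switching time `τ`: at the times `1, …, τ` send an update in both error states;
at later times send an update only if `(X, Y) = (0, 1)` in case `μ ≤ λ`,
and only if `(X, Y) = (1, 0)` in case `λ < μ`. -/
noncomputable def switchingPolicy (τ : ℕ) : UpdatePolicy := fun x h =>
  open Classical in
  PMF.pure (decide (
    (h.length ≤ τ ∧ x ≠ s.monitored x h) ∨
    (τ < h.length ∧ x = false ∧ s.monitored x h = true ∧ s.mu ≤ s.lam) ∨
    (τ < h.length ∧ x = true ∧ s.monitored x h = false ∧ s.lam < s.mu)))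

end RemoteSource

section Network

variable {N : ℕ} (S : Fin N → RemoteSource) (K : ℕ)

/-- For `m < N`, the probability that fewer than `K` of the sources that precede source `m` are free
at time `0`, the sources being independent; for `m = N` the value is `0` by convention. -/
noncomputable def priorityProb (m : Fin (N + 1)) : ℝ :=
  if m = Fin.last N then 0
  else (MeasureTheory.Measure.pi fun n => (S n).stationary.toMeasure).real
    {x : Fin N → Bool | (Finset.univ.filter fun n : Fin N => n.castSucc < m ∧ x n = true).card < K}

/-- `ρ(t)`, the minimum over `m` of `α_m + ∑_{n < m} α_n β_n(t)`, where `m = N` stands for the sum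
over all the sources. -/
noncomputable def errorApprox (U : Fin N → UpdatePolicy) (t : ℕ) : ℝ :=
  Finset.univ.inf' Finset.univ_nonempty fun m : Fin (N + 1) =>
    priorityProb S K m +
      ∑ n : Fin N with n.castSucc < m, priorityProb S K n.castSucc * (S n).errorProb (U n) t

noncomputable def avgErrorApprox (T : ℕ) (U : Fin N → UpdatePolicy) : ℝ :=
  1 / (T : ℝ) * ∑ t ∈ Finset.Icc 1 T, errorApprox S K U t

noncomputable def updateRate (T : ℕ) (U : Fin N → UpdatePolicy) : ℝ :=
  1 / (T : ℝ) * ∑ t ∈ Finset.Icc 1 T, ∑ n : Fin N, (S n).updateProb (U n) t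

/-- The threshold `α_n (1 / (2 ω_n) - 1)`. -/
noncomputable def sourceThreshold (n : Fin N) : ℝ :=
  priorityProb S K n.castSucc * (1 / (2 * (S n).omega) - 1)

/-- `τ(θ, m) = α_m - ∑_{n ≥ m} (ν_n / ζ_n) min (α_n, (α_n + θ) 2 ω_n)`; the value at `m = N` is `0`. -/
noncomputable def tailCost (θ : ℝ) (m : Fin (N + 1)) : ℝ :=
  priorityProb S K m -
    ∑ n : Fin N with m ≤ n.castSucc, (S n).nu / (S n).zeta *
      min (priorityProb S K n.castSucc) ((priorityProb S K n.castSucc + θ) * (2 * (S n).omega))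

/-- The set of the minimizers of `τ(θ, ·)`. -/
def tailArgmin (θ : ℝ) : Set (Fin (N + 1)) :=
  {m | ∀ m', tailCost S K θ m ≤ tailCost S K θ m'}

/-- `A(θ)`: the sources `n` before the least minimizer with `θ < α_n (1 / (2 ω_n) - 1)`. -/
noncomputable def innerSet (θ : ℝ) : Finset (Fin N) :=
  open Classical in
  Finset.univ.filter fun n =>
    θ < sourceThreshold S K n ∧ ∀ m ∈ tailArgmin S K θ, n.castSucc < m

/-- `B(θ)`: the sources `n` before the greatest minimizer with `θ ≤ α_n (1 / (2 ω_n) - 1)`. -/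
noncomputable def outerSet (θ : ℝ) : Finset (Fin N) :=
  open Classical in
  Finset.univ.filter fun n =>
    θ ≤ sourceThreshold S K n ∧ ∃ m ∈ tailArgmin S K θ, n.castSucc < m

/-- `T' = T (r - ∑_{A(θ)} 2 μ λ / ζ) / ∑_{B(θ) \ A(θ)} 2 μ λ / ζ`. -/
noncomputable def partialTime (T : ℕ) (r θ : ℝ) : ℝ :=
  T * ((r - ∑ n ∈ innerSet S K θ, (S n).changeRate) /
    ∑ n ∈ outerSet S K θ \ innerSet S K θ, (S n).changeRate)

/-- The switching times: `T` on `A(θ)`, `⌊T'⌋` on `B(θ) \ A(θ)`, and `0` elsewhere. -/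
noncomputable def switchingTime (T : ℕ) (r θ : ℝ) (n : Fin N) : ℕ :=
  if n ∈ innerSet S K θ then T
  else if n ∈ outerSet S K θ then ⌊partialTime S K T r θ⌋₊
  else 0

/-- The real numbers `θ` such that `r` lies between the rates of `A(θ)` and `B(θ)`. -/
def admissibleMultipliers (r : ℝ) : Set ℝ :=
  {θ | ∑ n ∈ innerSet S K θ, (S n).changeRate ≤ r ∧ r ≤ ∑ n ∈ outerSet S K θ, (S n).changeRate}

end Network

/-! The proof is by Lagrangian duality, with the multiplier `θ` as the price of an update.

For one source, let `a`, `b` be the probabilities of the two kinds of error after which no update is sent.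
The error probability of the next slot is `changeRate + (1 - 2 μ) a + (1 - 2 λ) b`, and `a`, `b` obey
linear balance equations (`ErrorFlow`).  If the source has weight `α`, the least steady cost per slot is
`ν / ζ * min (α, (α + θ) 2 ω)` (`RemoteSource.steadyCost`): either all errors are updated, or only those
in one error state, which makes the updates die out.  The minimum over `m` in `ρ(t)` lets a source count
in some slots and not in others, in an arbitrary pattern.  One linear potential nevertheless serves both
kinds of slots (`ErrorFlow.stage_bound`), apart from the excess of `μ a + λ b` over `μ λ / ζ`, which
contracts by `1 - ζ` in each slot and so costs `O(1 / ζ)` in total.  Summing over the sources and using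
that `m` minimizes the tail cost gives, for `θ ≥ 0`, the lower bound `network_lagrangian_lower`.

The switching policy attains this bound up to `O(N)` (`switching_lagrangian_upper`): charge the greatest
minimizer of the tail cost until the common switching time of `B(θ) \ A(θ)`, and the least one
afterwards; then every source is charged exactly its least steady cost in the slots in which it counts.
Its updates number `r T + O(N)`, as the updates after the switching time telescope
(`ErrorFlow.switching_updates_le`), and `θ ≤ 1 / δ`, so that comparing the two bounds gives optimality.

If many sources are given up anyway, the multiplier may be negative.  In that case `A(θ)` contains
all the sources that unconstrained updates would keep (`mem_innerSet_of_neg`), and the switching policy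
attains the unconstrained minimum.

The largest admissible `θ` is the supremum of the `θ` with `r ≤ ∑_{B(θ)} changeRate`: this set is closed,
contains `-1`, and is bounded above by the thresholds, while minimizers near `θ` are minimizers at `θ`,
so that `A(θ) ⊆ B(θ')` for `θ'` slightly above `θ`. -/

/-! ### The error flow of one source -/

/-- The balance equations of the two kinds of error of a two-state source, with `m` the probability of
passing from busy to free and `l` that of passing from free to busy.  At time `t`, `a t` and `u t` are
the probabilities that the source is busy, the monitor shows free, and respectively no update or an
update is sent; `b t` and `v t` are the same for a free source shown as busy.  Exchanging the two states
exchanges `m` with `l` and `a, u` with `b, v`. -/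
structure ErrorFlow (m l : ℝ) (a u b v : ℕ → ℝ) : Prop where
  m_pos : 0 < m
  l_pos : 0 < l
  m_lt : m < 1 / 2
  l_lt : l < 1 / 2
  a_nonneg : ∀ t, 0 ≤ a t
  u_nonneg : ∀ t, 0 ≤ u t
  b_nonneg : ∀ t, 0 ≤ b t
  v_nonneg : ∀ t, 0 ≤ v t
  busy_le : ∀ t, a t + u t ≤ l / (m + l)
  free_le : ∀ t, b t + v t ≤ m / (m + l)
  busy_succ : ∀ t, a (t + 1) + u (t + 1) = l * (m / (m + l) - b t) + (1 - m) * a t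
  free_succ : ∀ t, b (t + 1) + v (t + 1) = m * (l / (m + l) - a t) + (1 - l) * b t

namespace ErrorFlow

variable {m l : ℝ} {a u b v : ℕ → ℝ}

theorem symm (h : ErrorFlow m l a u b v) : ErrorFlow l m b v a u where
  m_pos := h.l_pos
  l_pos := h.m_pos
  m_lt := h.l_lt
  l_lt := h.m_lt
  a_nonneg := h.b_nonneg
  u_nonneg := h.v_nonneg
  b_nonneg := h.a_nonneg
  v_nonneg := h.u_nonneg
  busy_le := by simpa only [add_comm l m] using h.free_le
  free_le := by simpa only [add_comm l m] using h.busy_le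
  busy_succ := by simpa only [add_comm l m] using h.free_succ
  free_succ := by simpa only [add_comm l m] using h.busy_succ

theorem error_succ (h : ErrorFlow m l a u b v) (t : ℕ) :
    a (t + 1) + u (t + 1) + (b (t + 1) + v (t + 1)) =
      2 * m * l / (m + l) + (1 - 2 * m) * a t + (1 - 2 * l) * b t := by
  rw [h.busy_succ, h.free_succ]
  ring

theorem zeta_pos (h : ErrorFlow m l a u b v) : 0 < m + l := add_pos h.m_pos h.l_pos

theorem busy_le_one (h : ErrorFlow m l a u b v) (t : ℕ) : a t + u t ≤ 1 :=
  (h.busy_le t).trans ((div_le_one h.zeta_pos).2 (by linarith [h.m_pos]))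

theorem free_le_one (h : ErrorFlow m l a u b v) (t : ℕ) : b t + v t ≤ 1 := by
  have := h.symm.busy_le_one t
  exact this

/-- The excess of `m a + l b` over its equilibrium value without updates; in each slot it contracts
at least by the factor `1 - (m + l)`, whatever the updates are. -/
noncomputable def excess (m l : ℝ) (a b : ℕ → ℝ) (t : ℕ) : ℝ :=
  max (m * a t + l * b t - m * l / (m + l)) 0

theorem excess_le_one (h : ErrorFlow m l a u b v) (t : ℕ) : excess m l a b t ≤ 1 := by
  have ha : a t ≤ 1 := by linarith [h.busy_le_one t, h.u_nonneg t]
  have hb : b t ≤ 1 := by linarith [h.free_le_one t, h.v_nonneg t]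
  have : 0 ≤ m * l / (m + l) := div_nonneg (mul_pos h.m_pos h.l_pos).le h.zeta_pos.le
  refine max_le ?_ zero_le_one
  nlinarith [h.m_pos, h.l_pos, h.m_lt, h.l_lt]

theorem excess_succ (h : ErrorFlow m l a u b v) (t : ℕ) :
    (m + l) * excess m l a b t ≤ excess m l a b t - excess m l a b (t + 1) := by
  have hz := h.zeta_pos
  have hm := h.m_pos
  have hl := h.l_pos
  have h0 : 0 ≤ excess m l a b t := le_max_right _ _
  have h1 : m * a t + l * b t - m * l / (m + l) ≤ excess m l a b t := le_max_left _ _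
  have h1z : 0 ≤ 1 - (m + l) := by linarith [h.m_lt, h.l_lt]
  suffices excess m l a b (t + 1) ≤ (1 - (m + l)) * excess m l a b t by linarith
  refine max_le ?_ (mul_nonneg h1z h0)
  have e : m * (a (t + 1) + u (t + 1)) + l * (b (t + 1) + v (t + 1)) - m * l / (m + l) =
      (1 - (m + l)) * (m * a t + l * b t - m * l / (m + l)) := by
    rw [h.busy_succ, h.free_succ]
    field_simp
    ring
  have := mul_le_mul_of_nonneg_left h1 h1z
  nlinarith [h.u_nonneg (t + 1), h.v_nonneg (t + 1)]

/-- The one-slot inequality behind the lower bound: the Lagrangian cost of a slot, in which the source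
counts with the weight `x`, exceeds `x` times the least steady cost up to the decrease of
`θ (a + b) - κ b - (2 θ - κ) excess / (m + l)`. -/
theorem stage_bound (h : ErrorFlow m l a u b v) (hml : m ≤ l) {α θ κ : ℝ} (hα : 0 ≤ α)
    (hκ : κ = max 0 (2 * θ - α * (1 - 2 * l) / l)) (hθ : 0 ≤ θ) {x : ℝ} (hx : x = 0 ∨ x = 1) (t : ℕ) :
    x * (m / (m + l) * min α ((α + θ) * (2 * l)))
        + (θ * (a t + b t) - κ * b t - (2 * θ - κ) / (m + l) * excess m l a b t)
        - (θ * (a (t + 1) + b (t + 1)) - κ * b (t + 1)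
            - (2 * θ - κ) / (m + l) * excess m l a b (t + 1)) ≤
      x * (α * (a (t + 1) + u (t + 1) + (b (t + 1) + v (t + 1))))
        + θ * (u (t + 1) + v (t + 1)) := by
  have hz := h.zeta_pos
  have hm := h.m_pos
  have hl := h.l_pos
  have hθκ : 0 ≤ 2 * θ - κ := by
    have : 0 ≤ α * (1 - 2 * l) / l :=
      div_nonneg (mul_nonneg hα (by linarith [h.l_lt])) hl.le
    rw [hκ, sub_nonneg]
    exact max_le (by linarith) (by linarith)
  have hκ0 : 0 ≤ κ := hκ ▸ le_max_left _ _
  have hE0 : 0 ≤ excess m l a b t := le_max_right _ _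
  have hE1 : m * a t + l * b t - m * l / (m + l) ≤ excess m l a b t := le_max_left _ _
  -- The excess is paid for by its own decrease.
  have hG : (2 * θ - κ) * excess m l a b t ≤
      (2 * θ - κ) / (m + l) * (excess m l a b t - excess m l a b (t + 1)) := by
    calc (2 * θ - κ) * excess m l a b t
        = (2 * θ - κ) / (m + l) * ((m + l) * excess m l a b t) := by field_simp
      _ ≤ _ := mul_le_mul_of_nonneg_left (h.excess_succ t) (div_nonneg hθκ hz.le)
  have hG0 := mul_nonneg hθκ hE0
  -- Since `v ≥ 0`, the free errors without update cannot grow faster than without any update.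
  have hb : b (t + 1) ≤ m * (l / (m + l) - a t) + (1 - l) * b t := by
    linarith [h.free_succ t, h.v_nonneg (t + 1)]
  have hbκ := mul_le_mul_of_nonneg_left hb hκ0
  have hsum := h.error_succ t
  have e1 : m * (l / (m + l)) = m * l / (m + l) := by ring
  have e2 : 2 * m * l / (m + l) = 2 * (m * l / (m + l)) := by ring
  have huv : u (t + 1) + v (t + 1) = 2 * (m * l / (m + l)) + (1 - 2 * m) * a t + (1 - 2 * l) * b t
      - a (t + 1) - b (t + 1) := by linarith
  rw [hsum, huv, e2]
  have ec : m / (m + l) * ((α + θ) * (2 * l)) = (α + θ) * (2 * (m * l / (m + l))) := by ring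
  have ed : m / (m + l) * l = m * l / (m + l) := by ring
  rcases hx with rfl | rfl
  · have := mul_le_mul_of_nonneg_left hE1 hθκ
    have e3 : κ * (m * (l / (m + l) - a t) + (1 - l) * b t) =
        κ * (m * l / (m + l)) - κ * (m * a t) + κ * b t - κ * (l * b t) := by ring
    linarith
  · rcases le_total (2 * θ - α * (1 - 2 * l) / l) 0 with hc | hc
    · -- Below the threshold updating in both error states is optimal, and `κ = 0`.
      have k0 : κ = 0 := by rw [hκ, max_eq_left hc]
      have hc' : 2 * l * θ ≤ α * (1 - 2 * l) := by
        have := mul_le_mul_of_nonneg_left hc hl.le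
        have e : l * (2 * θ - α * (1 - 2 * l) / l) = 2 * l * θ - α * (1 - 2 * l) := by
          field_simp
        linarith
      have hca : 2 * m * θ ≤ α * (1 - 2 * m) := by nlinarith
      have ha := mul_nonneg (sub_nonneg.2 hca) (h.a_nonneg t)
      have hbb := mul_nonneg (sub_nonneg.2 hc') (h.b_nonneg t)
      have hmin := mul_le_mul_of_nonneg_left (min_le_right α ((α + θ) * (2 * l)))
        (div_nonneg hm.le hz.le)
      subst k0
      linarith
    · -- Above it the source is shown in its more frequent state; `κ` prices the errors `b`.
      have k0 : κ = 2 * θ - α * (1 - 2 * l) / l := by rw [hκ, max_eq_right hc]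
      have hkl : κ * l = 2 * l * θ - α * (1 - 2 * l) := by
        rw [k0]
        field_simp
      have hmin := mul_le_mul_of_nonneg_left (min_le_left α ((α + θ) * (2 * l)))
        (div_nonneg hm.le hz.le)
      have hlm : 0 ≤ α * (l - m) / l * a t :=
        mul_nonneg (div_nonneg (mul_nonneg hα (by linarith)) hl.le) (h.a_nonneg t)
      have hkm : κ * m = 2 * m * θ - α * m / l + 2 * m * α := by
        rw [k0]
        field_simp
        ring
      have e4 : α * (l - m) / l * a t = α * a t - α * m / l * a t := by
        field_simp
      have e5 : κ * (m * (l / (m + l) - a t) + (1 - l) * b t) =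
          κ * l * (m / (m + l)) - κ * m * a t + κ * b t - κ * l * b t := by ring
      rw [e5, hkl, hkm] at hbκ
      have e6 : (2 * l * θ - α * (1 - 2 * l)) * (m / (m + l)) =
          2 * θ * (m * l / (m + l)) - m / (m + l) * α + 2 * α * (m * l / (m + l)) := by ring
      rw [e6] at hbκ
      linarith

/-- Summed over the slots, for arbitrary weights in `{0, 1}`: the Lagrangian cost is at least the least
steady cost of the slots that count, up to a constant. -/
theorem lagrangian_lower (h : ErrorFlow m l a u b v) (hml : m ≤ l) {δ α θ : ℝ} (hδ : 0 < δ)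
    (hδz : δ ≤ m + l) (hα : 0 ≤ α) (hθ : 0 ≤ θ) (hθδ : θ ≤ 1 / δ) (x : ℕ → ℝ)
    (hx : ∀ t, x t = 0 ∨ x t = 1) (T : ℕ) :
    ∑ t ∈ Finset.range T, x (t + 1) * (m / (m + l) * min α ((α + θ) * (2 * l)))
        - (4 / δ + 2 / δ ^ 2) ≤
      ∑ t ∈ Finset.range T, (x (t + 1) * (α * (a (t + 1) + u (t + 1) + (b (t + 1) + v (t + 1))))
        + θ * (u (t + 1) + v (t + 1))) := by
  obtain ⟨κ, hκ⟩ : ∃ κ, κ = max 0 (2 * θ - α * (1 - 2 * l) / l) := ⟨_, rfl⟩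
  have hz := h.zeta_pos
  have hs := Finset.sum_le_sum fun t (_ : t ∈ Finset.range T) =>
    h.stage_bound hml hα hκ hθ (hx (t + 1)) t
  set Ψ : ℕ → ℝ := fun t => θ * (a t + b t) - κ * b t - (2 * θ - κ) / (m + l) * excess m l a b t
    with hΨ
  have htel : ∑ t ∈ Finset.range T, (Ψ t - Ψ (t + 1)) = Ψ 0 - Ψ T := Finset.sum_range_sub' _ _
  have hs' : ∑ t ∈ Finset.range T, x (t + 1) * (m / (m + l) * min α ((α + θ) * (2 * l)))
      + (Ψ 0 - Ψ T) ≤ ∑ t ∈ Finset.range T,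
        (x (t + 1) * (α * (a (t + 1) + u (t + 1) + (b (t + 1) + v (t + 1))))
        + θ * (u (t + 1) + v (t + 1))) := by
    rw [← htel, ← Finset.sum_add_distrib]
    refine le_trans (le_of_eq ?_) hs
    exact Finset.sum_congr rfl fun t _ => by simp only [hΨ]; ring
  have hκ0 : 0 ≤ κ := hκ ▸ le_max_left _ _
  have hκθ : κ ≤ 2 * θ := by
    have : 0 ≤ α * (1 - 2 * l) / l :=
      div_nonneg (mul_nonneg hα (by linarith [h.l_lt])) h.l_pos.le
    rw [hκ]
    exact max_le (by linarith) (by linarith)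
  have ha : ∀ t, a t ≤ 1 := fun t => by linarith [h.busy_le_one t, h.u_nonneg t]
  have hb : ∀ t, b t ≤ 1 := fun t => by linarith [h.free_le_one t, h.v_nonneg t]
  have hD0 : 0 ≤ (2 * θ - κ) / (m + l) := div_nonneg (by linarith) hz.le
  have hD : (2 * θ - κ) / (m + l) ≤ 2 / δ ^ 2 := by
    have : 2 / δ ^ 2 = (2 * (1 / δ)) / δ := by field_simp
    rw [this]
    exact div_le_div₀ (by positivity) (by linarith) hδ hδz
  have h0 : -(2 * θ) - 2 / δ ^ 2 ≤ Ψ 0 := by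
    have h1 := mul_le_mul_of_nonneg_left (h.excess_le_one 0) hD0
    have h2 := mul_le_mul_of_nonneg_left (hb 0) hκ0
    have h3 := mul_nonneg hθ (add_nonneg (h.a_nonneg 0) (h.b_nonneg 0))
    simp only [hΨ]
    linarith
  have hT : Ψ T ≤ 2 * θ := by
    have h1 : 0 ≤ (2 * θ - κ) / (m + l) * excess m l a b T := mul_nonneg hD0 (le_max_right _ _)
    have h2 := mul_nonneg hκ0 (h.b_nonneg T)
    have h3 := mul_le_mul_of_nonneg_left (add_le_add (ha T) (hb T)) hθ
    simp only [hΨ]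
    linarith
  have h4 : 4 / δ = 4 * (1 / δ) := by ring
  linarith

/-- The errors when updates are sent in both error states until time `τ`, and then only at a busy source
shown as free. -/
theorem switching_error_le (h : ErrorFlow m l a u b v) {τ : ℕ}
    (ha : ∀ t, 1 ≤ t → a t = 0) (hb : ∀ t, 1 ≤ t → t ≤ τ → b t = 0) {t : ℕ} (ht : 1 ≤ t) :
    a t + u t + (b t + v t) ≤
      (if t ≤ τ then 2 * m * l / (m + l) else m / (m + l)) + if t = 1 then 1 else 0 := by
  have hz := h.zeta_pos
  have hcr : 0 ≤ 2 * m * l / (m + l) :=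
    div_nonneg (mul_nonneg (by linarith [h.m_pos]) h.l_pos.le) hz.le
  obtain ⟨t, rfl⟩ := Nat.exists_eq_add_of_le' ht
  rcases Nat.eq_zero_or_pos t with rfl | ht0
  · have h1 := h.busy_le (0 + 1)
    have h2 := h.free_le (0 + 1)
    have h3 : l / (m + l) + m / (m + l) = 1 := by
      rw [← add_div, add_comm, div_self hz.ne']
    have h4 : 0 ≤ m / (m + l) := div_nonneg h.m_pos.le hz.le
    simp only [zero_add, if_true] at *
    split_ifs <;> linarith
  · rw [h.error_succ, ha t ht0, if_neg (by omega : ¬ t + 1 = 1)]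
    split_ifs with hτ
    · rw [hb t ht0 (by omega)]
      linarith
    · have h1 : b t ≤ m / (m + l) := by linarith [h.free_le t, h.v_nonneg t]
      have h2 := mul_le_mul_of_nonneg_left h1 (by linarith [h.l_lt] : 0 ≤ 1 - 2 * l)
      have h3 : (1 - 2 * l) * (m / (m + l)) = m / (m + l) - 2 * m * l / (m + l) := by ring
      linarith

/-- The number of updates under the same policy.  After the switching time the probability of an update
telescopes, since `b` tends to its equilibrium `m / (m + l)`. -/
theorem switching_updates_le (h : ErrorFlow m l a u b v) {τ : ℕ}
    (ha : ∀ t, 1 ≤ t → a t = 0) (hb : ∀ t, 1 ≤ t → t ≤ τ → b t = 0)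
    (hv : ∀ t, τ < t → v t = 0) (T : ℕ) :
    ∑ t ∈ Finset.Icc 1 T, (u t + v t) ≤ τ * (2 * m * l / (m + l)) + 3 := by
  have hz := h.zeta_pos
  have hcr : 0 ≤ 2 * m * l / (m + l) :=
    div_nonneg (mul_nonneg (by linarith [h.m_pos]) h.l_pos.le) hz.le
  have hm1 : m / (m + l) ≤ 1 := (div_le_one hz).2 (by linarith [h.l_pos])
  have key : (T ≤ τ → ∑ t ∈ Finset.Icc 1 T, (u t + v t) ≤ T * (2 * m * l / (m + l)) + 1) ∧
      (τ < T → ∑ t ∈ Finset.Icc 1 T, (u t + v t) ≤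
        τ * (2 * m * l / (m + l)) + 3 - (m / (m + l) - b T)) := by
    induction T with
    | zero => simp
    | succ T ih =>
      rw [Finset.sum_Icc_succ_top (by omega)]
      constructor
      · intro hT
        have ih1 := ih.1 (by omega)
        push_cast
        rcases Nat.eq_zero_or_pos T with rfl | hT0
        · have h1 := h.busy_le (0 + 1)
          have h2 := h.free_le (0 + 1)
          have h3 : l / (m + l) + m / (m + l) = 1 := by
            rw [← add_div, add_comm, div_self hz.ne']
          simp only [Finset.Icc_eq_empty_of_lt zero_lt_one, Finset.sum_empty]
          push_cast
          linarith [h.a_nonneg (0 + 1), h.b_nonneg (0 + 1)]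
        · have h1 := h.error_succ T
          rw [ha T hT0, hb T hT0 (by omega), ha _ (by omega), hb _ (by omega) hT] at h1
          linarith
      · intro hT
        rw [hv _ hT]
        rcases (Nat.lt_succ_iff.1 hT).eq_or_lt with rfl | hT'
        · have ih1 := ih.1 le_rfl
          have h1 := h.busy_le_one (τ + 1)
          linarith [h.a_nonneg (τ + 1), h.b_nonneg (τ + 1)]
        · have ih2 := ih.2 hT'
          have h1 := h.busy_succ T
          have h2 := h.free_succ T
          rw [ha T (by omega), ha (T + 1) (by omega)] at h1
          rw [ha T (by omega), hv _ hT] at h2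
          have e : l * (m / (m + l)) = m * (l / (m + l)) := by ring
          linarith
  rcases le_or_gt T τ with hT | hT
  · have h1 := key.1 hT
    have h2 : (T : ℝ) * (2 * m * l / (m + l)) ≤ τ * (2 * m * l / (m + l)) :=
      mul_le_mul_of_nonneg_right (by exact_mod_cast hT) hcr
    linarith
  · have h1 := key.2 hT
    linarith [h.free_le T, h.v_nonneg T]

end ErrorFlow

/-! ### The joint law of state, monitored value and update -/

namespace RemoteSource

variable (s : RemoteSource)

/-- The joint law of the state, the monitored value and the update indicator at time `t`. -/
noncomputable def jointLaw (U : UpdatePolicy) (t : ℕ) : PMF (Bool × Bool × Bool) :=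
  (s.law U t).bind fun p => (updateLaw U p.1 p.2).map fun u => (p.1, s.monitored p.1 p.2, u)

noncomputable def jointProb (U : UpdatePolicy) (t : ℕ) (x y u : Bool) : ℝ :=
  (s.jointLaw U t (x, y, u)).toReal

theorem jointProb_nonneg (U : UpdatePolicy) (t : ℕ) (x y u : Bool) : 0 ≤ s.jointProb U t x y u :=
  ENNReal.toReal_nonneg

theorem map_jointLaw (U : UpdatePolicy) (t : ℕ) :
    (s.jointLaw U t).map (fun q => (q.1, q.2.1)) =
      (s.law U t).map fun p => (p.1, s.monitored p.1 p.2) := by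
  simp only [jointLaw, PMF.map_bind, PMF.map_comp, Function.comp_def]
  simp only [PMF.map, Function.comp_def, PMF.bind_const]

theorem law_succ_map (U : UpdatePolicy) (t : ℕ) :
    (s.law U (t + 1)).map (fun p => (p.1, s.monitored p.1 p.2)) =
      (s.jointLaw U t).bind fun q =>
        (s.step q.1).map fun x' => (x', if q.2.2 then q.1 else q.2.1) := by
  simp only [jointLaw, law, PMF.map_bind, PMF.bind_bind, PMF.map_comp, Function.comp_def,
    PMF.bind_map, monitored]

theorem map_toReal_apply {α β : Type*} [Fintype α] [DecidableEq β] (P : PMF α) (f : α → β) (b : β) :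
    (P.map f b).toReal = ∑ q, if b = f q then (P q).toReal else 0 := by
  rw [PMF.map_apply, tsum_fintype, ENNReal.toReal_sum]
  · refine Finset.sum_congr rfl fun q _ => ?_
    split_ifs <;> simp
  · intro q _
    split_ifs
    · exact P.apply_ne_top q
    · simp

theorem bind_toReal_apply {α β : Type*} [Fintype α] (P : PMF α) (f : α → PMF β) (b : β) :
    (P.bind f b).toReal = ∑ q, (P q).toReal * (f q b).toReal := by
  rw [PMF.bind_apply, tsum_fintype, ENNReal.toReal_sum]
  · simp
  · intro q _
    exact ENNReal.mul_ne_top (P.apply_ne_top q) ((f q).apply_ne_top b)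

theorem coinLaw_true {p : ℝ} (h0 : 0 ≤ p) (h1 : p ≤ 1) : (coinLaw p h0 h1 true).toReal = p := by
  simp [coinLaw, h0]

theorem coinLaw_false {p : ℝ} (h0 : 0 ≤ p) (h1 : p ≤ 1) :
    (coinLaw p h0 h1 false).toReal = 1 - p := by
  simp [coinLaw, h1]

/-- The joint law of the next state and the next monitored value. -/
theorem jointProb_succ (U : UpdatePolicy) (t : ℕ) (x' y' : Bool) :
    s.jointProb U (t + 1) x' y' false + s.jointProb U (t + 1) x' y' true =
      ∑ x, ∑ y, ∑ u, s.jointProb U t x y u *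
        if y' = (if u then x else y) then (s.step x x').toReal else 0 := by
  have h := congrArg (fun P => (P (x', y')).toReal)
    ((s.map_jointLaw U (t + 1)).trans (s.law_succ_map U t))
  simp only [map_toReal_apply, bind_toReal_apply, Fintype.sum_prod_type] at h
  simp only [Fintype.sum_bool] at h ⊢
  unfold jointProb
  cases x' <;> cases y' <;> simp at h ⊢ <;> linarith

theorem errorProb_eq (U : UpdatePolicy) (t : ℕ) :
    s.errorProb U t = s.jointProb U t false true false + s.jointProb U t false true true +
      (s.jointProb U t true false false + s.jointProb U t true false true) := by
  have e : ((s.law U t).map fun p => p.1 != s.monitored p.1 p.2) =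
      (s.jointLaw U t).map fun q => q.1 != q.2.1 := by
    have := congrArg (PMF.map fun q : Bool × Bool => q.1 != q.2) (s.map_jointLaw U t)
    simpa only [PMF.map_comp, Function.comp_def] using this.symm
  rw [errorProb, e, map_toReal_apply]
  simp only [Fintype.sum_prod_type, Fintype.sum_bool, jointProb]
  simp
  ring

theorem updateProb_eq (U : UpdatePolicy) (t : ℕ) :
    s.updateProb U t = ∑ x, ∑ y, s.jointProb U t x y true := by
  have e : ((s.law U t).bind fun p => updateLaw U p.1 p.2) =
      (s.jointLaw U t).map fun q => q.2.2 := by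
    simp only [jointLaw, PMF.map_bind, PMF.map_comp, Function.comp_def]
    congr 1
    funext p
    exact (PMF.map_id _).symm
  rw [updateProb, e, map_toReal_apply]
  simp only [Fintype.sum_prod_type, Fintype.sum_bool, jointProb]
  simp

theorem zeta_pos : 0 < s.zeta := add_pos s.mu_pos s.lam_pos

/-- The state keeps its stationary law. -/
theorem jointProb_marginal (U : UpdatePolicy) (t : ℕ) :
    ∑ y, ∑ u, s.jointProb U t true y u = s.mu / s.zeta ∧
      ∑ y, ∑ u, s.jointProb U t false y u = s.lam / s.zeta := by
  have hz := s.zeta_pos.ne'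
  have hz' : s.mu + s.lam ≠ 0 := hz
  induction t with
  | zero =>
    have e : (s.jointLaw U 0).map (fun q => q.1) = s.stationary := by
      have := congrArg (PMF.map Prod.fst) (s.map_jointLaw U 0)
      simp only [PMF.map_comp, Function.comp_def, law] at this
      rw [this]
      exact PMF.map_id _
    have h1 := congrArg (fun P => (P true).toReal) e
    have h2 := congrArg (fun P => (P false).toReal) e
    simp only [map_toReal_apply, Fintype.sum_prod_type, stationary, coinLaw_true, coinLaw_false]
      at h1 h2
    simp only [Fintype.sum_bool, jointProb] at h1 h2 ⊢
    simp at h1 h2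
    refine ⟨by linarith, ?_⟩
    have : s.lam / s.zeta = 1 - s.mu / s.zeta := by
      unfold zeta
      field_simp
      ring
    linarith
  | succ t ih =>
    obtain ⟨i1, i2⟩ := ih
    have h1 := s.jointProb_succ U t true true
    have h2 := s.jointProb_succ U t true false
    have h3 := s.jointProb_succ U t false true
    have h4 := s.jointProb_succ U t false false
    simp only [Fintype.sum_bool] at *
    simp [step, coinLaw_true, coinLaw_false] at h1 h2 h3 h4
    have e1 : s.mu / s.zeta = (1 - s.lam) * (s.mu / s.zeta) + s.mu * (s.lam / s.zeta) := by ring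
    have e2 : s.lam / s.zeta = s.lam * (s.mu / s.zeta) + (1 - s.mu) * (s.lam / s.zeta) := by ring
    constructor
    · rw [e1, ← i1, ← i2]
      linarith
    · rw [e2, ← i1, ← i2]
      linarith

theorem errorFlow (U : UpdatePolicy) : ErrorFlow s.mu s.lam
    (fun t => s.jointProb U t false true false) (fun t => s.jointProb U t false true true)
    (fun t => s.jointProb U t true false false) (fun t => s.jointProb U t true false true) where
  m_pos := s.mu_pos
  l_pos := s.lam_pos
  m_lt := s.mu_lt
  l_lt := s.lam_lt
  a_nonneg t := s.jointProb_nonneg U t _ _ _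
  u_nonneg t := s.jointProb_nonneg U t _ _ _
  b_nonneg t := s.jointProb_nonneg U t _ _ _
  v_nonneg t := s.jointProb_nonneg U t _ _ _
  busy_le t := by
    have := (s.jointProb_marginal U t).2
    simp only [Fintype.sum_bool, zeta] at this
    linarith [s.jointProb_nonneg U t false false false, s.jointProb_nonneg U t false false true]
  free_le t := by
    have := (s.jointProb_marginal U t).1
    simp only [Fintype.sum_bool, zeta] at this
    linarith [s.jointProb_nonneg U t true true false, s.jointProb_nonneg U t true true true]
  busy_succ t := by
    have h1 := (s.jointProb_marginal U t).1
    have h2 := s.jointProb_succ U t false true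
    simp only [Fintype.sum_bool] at *
    simp [step, coinLaw_false] at h2
    rw [h2]
    unfold zeta at h1
    rw [← h1]
    ring
  free_succ t := by
    have h1 := (s.jointProb_marginal U t).2
    have h2 := s.jointProb_succ U t true false
    simp only [Fintype.sum_bool] at *
    simp [step, coinLaw_true] at h2
    rw [h2]
    unfold zeta at h1
    rw [← h1]
    ring

end RemoteSource

theorem sum_Icc_one_eq_sum_range (f : ℕ → ℝ) (T : ℕ) :
    ∑ t ∈ Finset.Icc 1 T, f t = ∑ t ∈ Finset.range T, f (t + 1) := by
  induction T with
  | zero => simp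
  | succ T ih => rw [Finset.sum_Icc_succ_top (by omega), Finset.sum_range_succ, ih]

/-! ### Bounds for one source -/

namespace RemoteSource

variable (s : RemoteSource)

theorem changeRate_nonneg : 0 ≤ s.changeRate :=
  div_nonneg (mul_nonneg (mul_nonneg zero_le_two s.mu_pos.le) s.lam_pos.le) s.zeta_pos.le

theorem changeRate_pos : 0 < s.changeRate :=
  div_pos (mul_pos (mul_pos zero_lt_two s.mu_pos) s.lam_pos) s.zeta_pos

theorem changeRate_le_one : s.changeRate ≤ 1 := by
  rw [changeRate, div_le_one s.zeta_pos, zeta]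
  nlinarith [s.mu_pos, s.lam_pos, s.mu_lt, s.lam_lt]

theorem nu_mul_omega : s.nu / s.zeta * (2 * s.omega) = s.changeRate := by
  have : s.nu * s.omega = s.lam * s.mu := min_mul_max _ _
  rw [changeRate, div_mul_eq_mul_div]
  congr 1
  linear_combination 2 * this

theorem omega_pos : 0 < s.omega := lt_max_of_lt_left s.lam_pos

theorem omega_lt : s.omega < 1 / 2 := max_lt s.lam_lt s.mu_lt

theorem nu_nonneg : 0 ≤ s.nu := le_min s.lam_pos.le s.mu_pos.le

theorem zeta_le_two_omega : s.zeta ≤ 2 * s.omega := by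
  have h1 : s.lam ≤ s.omega := le_max_left _ _
  have h2 : s.mu ≤ s.omega := le_max_right _ _
  rw [zeta]
  linarith

/-- Updates in both error states attain the least possible error probability in every slot. -/
theorem changeRate_le_errorProb (U : UpdatePolicy) {t : ℕ} (ht : 1 ≤ t) :
    s.changeRate ≤ s.errorProb U t := by
  obtain ⟨t, rfl⟩ := Nat.exists_eq_add_of_le' ht
  have h := s.errorFlow U
  have h1 := h.error_succ t
  rw [errorProb_eq, h1, changeRate, zeta]
  have h2 := mul_nonneg (by linarith [s.mu_lt] : 0 ≤ 1 - 2 * s.mu) (h.a_nonneg t)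
  have h3 := mul_nonneg (by linarith [s.lam_lt] : 0 ≤ 1 - 2 * s.lam) (h.b_nonneg t)
  linarith

theorem errorUpdates_le_updateProb (U : UpdatePolicy) (t : ℕ) :
    s.jointProb U t false true true + s.jointProb U t true false true ≤ s.updateProb U t := by
  rw [updateProb_eq]
  simp only [Fintype.sum_bool]
  linarith [s.jointProb_nonneg U t true true true, s.jointProb_nonneg U t false false true]

/-- The least steady Lagrangian cost of a source of weight `α`, for the price `θ` of an update. -/
noncomputable def steadyCost (α θ : ℝ) : ℝ :=
  s.nu / s.zeta * min α ((α + θ) * (2 * s.omega))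

theorem lagrangian_lower (U : UpdatePolicy) {δ α θ : ℝ} (hδ : 0 < δ) (hδz : δ ≤ s.zeta)
    (hα : 0 ≤ α) (hθ : 0 ≤ θ) (hθδ : θ ≤ 1 / δ) (x : ℕ → ℝ) (hx : ∀ t, x t = 0 ∨ x t = 1) (T : ℕ) :
    ∑ t ∈ Finset.Icc 1 T, x t * s.steadyCost α θ - (4 / δ + 2 / δ ^ 2) ≤
      ∑ t ∈ Finset.Icc 1 T, (x t * (α * s.errorProb U t) + θ * s.updateProb U t) := by
  have h := s.errorFlow U
  rw [sum_Icc_one_eq_sum_range, sum_Icc_one_eq_sum_range]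
  have hu : ∀ t, θ * (s.jointProb U t false true true + s.jointProb U t true false true) ≤
      θ * s.updateProb U t :=
    fun t => mul_le_mul_of_nonneg_left (s.errorUpdates_le_updateProb U t) hθ
  rcases le_total s.mu s.lam with hml | hml
  · refine (le_trans (le_of_eq ?_) (h.lagrangian_lower hml hδ hδz hα hθ hθδ x hx T)).trans
      (Finset.sum_le_sum fun t _ => ?_)
    · rw [steadyCost, nu, omega, min_eq_right hml, max_eq_left hml, zeta]
    · rw [errorProb_eq]
      linarith [hu (t + 1)]
  · refine (le_trans (le_of_eq ?_) (h.symm.lagrangian_lower hml hδ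
      (by rw [add_comm]; exact hδz) hα hθ hθδ x hx T)).trans (Finset.sum_le_sum fun t _ => ?_)
    · rw [steadyCost, nu, omega, min_eq_left hml, max_eq_right hml, zeta, add_comm s.lam s.mu]
    · rw [errorProb_eq, add_comm (_ + _) (s.jointProb U (t + 1) true false false + _)]
      linarith [hu (t + 1)]

theorem length_of_mem_support_law (U : UpdatePolicy) (t : ℕ) :
    ∀ p ∈ (s.law U t).support, p.2.length = t := by
  induction t with
  | zero =>
    intro p hp
    obtain ⟨x, -, rfl⟩ := (PMF.mem_support_map_iff _ _ _).1 hp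
    rfl
  | succ t ih =>
    intro p hp
    obtain ⟨q, hq, hp⟩ := (PMF.mem_support_bind_iff _ _ _).1 hp
    obtain ⟨u, -, hp⟩ := (PMF.mem_support_bind_iff _ _ _).1 hp
    obtain ⟨x, -, rfl⟩ := (PMF.mem_support_map_iff _ _ _).1 hp
    simp [ih q hq]

theorem switching_jointProb_eq_zero (τ : ℕ) {t : ℕ} (ht : 1 ≤ t) {x y u : Bool}
    (h : ¬ (u = true ↔ ((t ≤ τ ∧ x ≠ y) ∨ (τ < t ∧ x = false ∧ y = true ∧ s.mu ≤ s.lam) ∨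
      (τ < t ∧ x = true ∧ y = false ∧ s.lam < s.mu)))) :
    s.jointProb (s.switchingPolicy τ) t x y u = 0 := by
  by_contra h0
  have hmem : (x, y, u) ∈ (s.jointLaw (s.switchingPolicy τ) t).support := by
    rw [PMF.mem_support_iff]
    intro h1
    exact h0 (by rw [jointProb, h1, ENNReal.toReal_zero])
  obtain ⟨p, hp, hm⟩ := (PMF.mem_support_bind_iff _ _ _).1 hmem
  obtain ⟨u', hu', he⟩ := (PMF.mem_support_map_iff _ _ _).1 hm
  have hlen := s.length_of_mem_support_law _ t p hp
  have hne : p.2 ≠ [] := by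
    intro h1
    rw [h1] at hlen
    simp at hlen
    omega
  obtain ⟨rfl, rfl, rfl⟩ : p.1 = x ∧ s.monitored p.1 p.2 = y ∧ u' = u := by simpa using he
  rw [updateLaw, if_neg hne, switchingPolicy, PMF.mem_support_pure_iff, hlen] at hu'
  exact h (by rw [hu', decide_eq_true_eq])

theorem switching_errorProb_le (τ : ℕ) {t : ℕ} (ht : 1 ≤ t) :
    s.errorProb (s.switchingPolicy τ) t ≤
      (if t ≤ τ then s.changeRate else s.nu / s.zeta) + if t = 1 then 1 else 0 := by
  have h := s.errorFlow (s.switchingPolicy τ)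
  rcases le_or_gt s.mu s.lam with hml | hml
  · rw [errorProb_eq, changeRate, nu, min_eq_right hml, zeta]
    refine h.switching_error_le (fun t ht => ?_) (fun t ht hτ => ?_) ht
    · refine s.switching_jointProb_eq_zero τ ht ?_
      simp [hml, le_or_gt]
    · refine s.switching_jointProb_eq_zero τ ht ?_
      simp [hτ]
  · rw [errorProb_eq, changeRate, nu, min_eq_left hml.le, zeta, add_comm (_ + _) (_ + _),
      mul_right_comm, add_comm s.mu]
    refine h.symm.switching_error_le (fun t ht => ?_) (fun t ht hτ => ?_) ht
    · refine s.switching_jointProb_eq_zero τ ht ?_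
      simp [hml, le_or_gt]
    · refine s.switching_jointProb_eq_zero τ ht ?_
      simp [hτ]

theorem switching_updateProb_sum_le (τ T : ℕ) :
    ∑ t ∈ Finset.Icc 1 T, s.updateProb (s.switchingPolicy τ) t ≤ τ * s.changeRate + 3 := by
  have h := s.errorFlow (s.switchingPolicy τ)
  have hu : ∀ t ∈ Finset.Icc 1 T, s.updateProb (s.switchingPolicy τ) t =
      s.jointProb (s.switchingPolicy τ) t false true true +
        s.jointProb (s.switchingPolicy τ) t true false true := by
    intro t ht
    have ht1 := (Finset.mem_Icc.1 ht).1
    rw [updateProb_eq]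
    simp only [Fintype.sum_bool]
    rw [s.switching_jointProb_eq_zero τ (x := true) (y := true) ht1 (by simp),
      s.switching_jointProb_eq_zero τ (x := false) (y := false) ht1 (by simp)]
    ring
  rw [Finset.sum_congr rfl hu]
  rcases le_or_gt s.mu s.lam with hml | hml
  · rw [changeRate, zeta]
    refine h.switching_updates_le (fun t ht => ?_) (fun t ht hτ => ?_) (fun t hτ => ?_) T
    · refine s.switching_jointProb_eq_zero τ ht ?_
      simp [hml, le_or_gt]
    · refine s.switching_jointProb_eq_zero τ ht ?_
      simp [hτ]
    · refine s.switching_jointProb_eq_zero τ (by omega) ?_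
      simp [hτ, hml]
  · rw [changeRate, zeta, mul_right_comm, add_comm s.mu]
    simp only [add_comm (s.jointProb _ _ false true true)]
    refine h.symm.switching_updates_le (fun t ht => ?_) (fun t ht hτ => ?_) (fun t hτ => ?_) T
    · refine s.switching_jointProb_eq_zero τ ht ?_
      simp [hml, le_or_gt]
    · refine s.switching_jointProb_eq_zero τ ht ?_
      simp [hτ]
    · refine s.switching_jointProb_eq_zero τ (by omega) ?_
      simp [hτ, hml]

end RemoteSource

section Network

variable {N : ℕ} (S : Fin N → RemoteSource) (K : ℕ)

/-! ### The minimizers of the tail cost -/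

theorem priorityProb_nonneg (m : Fin (N + 1)) : 0 ≤ priorityProb S K m := by
  unfold priorityProb
  split_ifs
  · exact le_rfl
  · exact MeasureTheory.measureReal_nonneg

theorem priorityProb_le_one (m : Fin (N + 1)) : priorityProb S K m ≤ 1 := by
  unfold priorityProb
  split_ifs
  · exact zero_le_one
  · exact MeasureTheory.measureReal_le_one

/-- The least steady Lagrangian cost per slot when exactly the sources before `m` count. -/
noncomputable def headCost (θ : ℝ) (m : Fin (N + 1)) : ℝ :=
  priorityProb S K m +
    ∑ n : Fin N with n.castSucc < m, (S n).steadyCost (priorityProb S K n.castSucc) θ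

theorem headCost_eq (θ : ℝ) (m : Fin (N + 1)) :
    headCost S K θ m = tailCost S K θ m +
      ∑ n : Fin N, (S n).steadyCost (priorityProb S K n.castSucc) θ := by
  have h := Finset.sum_filter_add_sum_filter_not Finset.univ (fun n : Fin N => n.castSucc < m)
    fun n => (S n).steadyCost (priorityProb S K n.castSucc) θ
  simp only [not_lt] at h
  rw [headCost, tailCost, ← h]
  simp only [RemoteSource.steadyCost]
  ring

theorem headCost_le {θ : ℝ} {m : Fin (N + 1)} (hm : m ∈ tailArgmin S K θ) (m' : Fin (N + 1)) :
    headCost S K θ m ≤ headCost S K θ m' := by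
  rw [headCost_eq, headCost_eq]
  linarith [hm m']

theorem continuous_tailCost (m : Fin (N + 1)) : Continuous fun θ => tailCost S K θ m := by
  unfold tailCost
  fun_prop

theorem tailArgmin_nonempty (θ : ℝ) : (tailArgmin S K θ).Nonempty := by
  obtain ⟨m, hm⟩ := Finite.exists_min (tailCost S K θ)
  exact ⟨m, hm⟩

theorem exists_least_tailArgmin (θ : ℝ) :
    ∃ m ∈ tailArgmin S K θ, ∀ m' ∈ tailArgmin S K θ, m ≤ m' :=
  Set.exists_min_image _ id (Set.toFinite _) (tailArgmin_nonempty S K θ)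

theorem exists_greatest_tailArgmin (θ : ℝ) :
    ∃ m ∈ tailArgmin S K θ, ∀ m' ∈ tailArgmin S K θ, m' ≤ m :=
  Set.exists_max_image _ id (Set.toFinite _) (tailArgmin_nonempty S K θ)

theorem innerSet_subset_outerSet (θ : ℝ) : innerSet S K θ ⊆ outerSet S K θ := by
  intro n hn
  simp only [innerSet, outerSet, Finset.mem_filter, Finset.mem_univ, true_and] at *
  obtain ⟨m, hm⟩ := tailArgmin_nonempty S K θ
  exact ⟨hn.1.le, m, hm, hn.2 m hm⟩

theorem sourceThreshold_nonneg (n : Fin N) : 0 ≤ sourceThreshold S K n := by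
  refine mul_nonneg (priorityProb_nonneg S K _) (sub_nonneg.2 ?_)
  rw [le_div_iff₀ (by linarith [(S n).omega_pos])]
  linarith [(S n).omega_lt]

theorem sourceThreshold_le {δ : ℝ} (hδ : 0 < δ) (n : Fin N) (hn : δ ≤ (S n).zeta) :
    sourceThreshold S K n ≤ 1 / δ := by
  have h1 : 1 / (2 * (S n).omega) ≤ 1 / δ :=
    one_div_le_one_div_of_le hδ (hn.trans (S n).zeta_le_two_omega)
  have h2 := sourceThreshold_nonneg S K n
  have h0 := priorityProb_nonneg S K n.castSucc
  have h3 := priorityProb_le_one S K n.castSucc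
  have h4 : 0 < 1 / (2 * (S n).omega) := one_div_pos.2 (by linarith [(S n).omega_pos])
  unfold sourceThreshold at *
  nlinarith

theorem steadyCost_of_le {θ : ℝ} {n : Fin N} (h : θ ≤ sourceThreshold S K n) :
    (S n).steadyCost (priorityProb S K n.castSucc) θ =
      (priorityProb S K n.castSucc + θ) * (S n).changeRate := by
  have hω := (S n).omega_pos
  rw [RemoteSource.steadyCost, min_eq_right, ← (S n).nu_mul_omega]
  · ring
  · have := mul_le_mul_of_nonneg_right h (by linarith : 0 ≤ 2 * (S n).omega)
    have e : sourceThreshold S K n * (2 * (S n).omega) =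
        priorityProb S K n.castSucc - priorityProb S K n.castSucc * (2 * (S n).omega) := by
      unfold sourceThreshold
      field_simp
    linarith

theorem steadyCost_of_ge {θ : ℝ} {n : Fin N} (h : sourceThreshold S K n ≤ θ) :
    (S n).steadyCost (priorityProb S K n.castSucc) θ =
      priorityProb S K n.castSucc * ((S n).nu / (S n).zeta) := by
  have hω := (S n).omega_pos
  rw [RemoteSource.steadyCost, min_eq_left, mul_comm]
  have := mul_le_mul_of_nonneg_right h (by linarith : 0 ≤ 2 * (S n).omega)
  have e : sourceThreshold S K n * (2 * (S n).omega) =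
      priorityProb S K n.castSucc - priorityProb S K n.castSucc * (2 * (S n).omega) := by
    unfold sourceThreshold
    field_simp
  linarith

/-! ### The largest admissible multiplier -/

theorem isClosed_setOf_mem_tailArgmin (m : Fin (N + 1)) :
    IsClosed {θ | m ∈ tailArgmin S K θ} := by
  have e : {θ | m ∈ tailArgmin S K θ} =
      ⋂ m', {θ | tailCost S K θ m ≤ tailCost S K θ m'} := by
    ext θ
    simp [tailArgmin]
  rw [e]
  exact isClosed_iInter fun m' =>
    isClosed_le (continuous_tailCost S K m) (continuous_tailCost S K m')

theorem isClosed_setOf_mem_outerSet (n : Fin N) : IsClosed {θ | n ∈ outerSet S K θ} := by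
  have e : {θ | n ∈ outerSet S K θ} = Set.Iic (sourceThreshold S K n) ∩
      ⋃ m ∈ {m : Fin (N + 1) | n.castSucc < m}, {θ | m ∈ tailArgmin S K θ} := by
    ext θ
    simp [outerSet, and_comm]
  rw [e]
  exact isClosed_Iic.inter
    ((Set.toFinite _).isClosed_biUnion fun m _ => isClosed_setOf_mem_tailArgmin S K m)

theorem isClosed_setOf_le_outer_rate (r : ℝ) :
    IsClosed {θ | r ≤ ∑ n ∈ outerSet S K θ, (S n).changeRate} := by
  have e : {θ | r ≤ ∑ n ∈ outerSet S K θ, (S n).changeRate} =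
      ⋃ F ∈ {F : Finset (Fin N) | r ≤ ∑ n ∈ F, (S n).changeRate},
        ⋂ n ∈ F, {θ | n ∈ outerSet S K θ} := by
    ext θ
    simp only [Set.mem_ofPred_eq, Set.mem_iUnion, Set.mem_iInter, exists_prop]
    constructor
    · exact fun h => ⟨_, h, fun n hn => hn⟩
    · rintro ⟨F, hF, hsub⟩
      exact hF.trans (Finset.sum_le_sum_of_subset_of_nonneg hsub
        fun n _ _ => (S n).changeRate_nonneg)
  rw [e]
  exact (Set.toFinite _).isClosed_biUnion fun F _ =>
    isClosed_biInter fun n _ => isClosed_setOf_mem_outerSet S K n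

/-- Near `θ` the outer set contains the inner set at `θ`, since by continuity every minimizer near `θ`
is a minimizer at `θ`. -/
theorem eventually_innerSet_subset_outerSet (θ : ℝ) :
    ∀ᶠ θ' in nhds θ, innerSet S K θ ⊆ outerSet S K θ' := by
  have h1 : ∀ᶠ θ' in nhds θ, tailArgmin S K θ' ⊆ tailArgmin S K θ := by
    have : ∀ᶠ θ' in nhds θ, ∀ m : Fin (N + 1), m ∉ tailArgmin S K θ → m ∉ tailArgmin S K θ' := by
      refine Filter.eventually_all.2 fun m => ?_
      by_cases hm : m ∈ tailArgmin S K θ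
      · exact Filter.Eventually.of_forall fun _ h => absurd hm h
      · filter_upwards [(isClosed_setOf_mem_tailArgmin S K m).isOpen_compl.mem_nhds hm]
          with θ' h _ using h
    filter_upwards [this] with θ' h m hm
    by_contra hc
    exact h m hc hm
  have h2 : ∀ᶠ θ' in nhds θ, ∀ n : Fin N, θ < sourceThreshold S K n →
      θ' < sourceThreshold S K n := by
    refine Filter.eventually_all.2 fun n => ?_
    by_cases hn : θ < sourceThreshold S K n
    · filter_upwards [Iio_mem_nhds hn] with θ' h _ using h
    · exact Filter.Eventually.of_forall fun _ h => absurd h hn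
  filter_upwards [h1, h2] with θ' h1 h2 n hn
  simp only [innerSet, outerSet, Finset.mem_filter, Finset.mem_univ, true_and] at *
  obtain ⟨m, hm⟩ := tailArgmin_nonempty S K θ'
  exact ⟨(h2 n hn.1).le, m, hm, hn.2 m (h1 hm)⟩

/-- For the price `-1` the sum in the tail cost is nonpositive, so that no source is given up. -/
theorem outerSet_neg_one : outerSet S K (-1) = Finset.univ := by
  refine Finset.eq_univ_of_forall fun n => ?_
  simp only [outerSet, Finset.mem_filter, Finset.mem_univ, true_and]
  refine ⟨by linarith [sourceThreshold_nonneg S K n], Fin.last N, fun m => ?_, Fin.castSucc_lt_last n⟩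
  have h1 : tailCost S K (-1) (Fin.last N) = 0 := by
    simp [tailCost, priorityProb, Fin.last_le_iff, Fin.castSucc_ne_last]
  rw [h1, tailCost, sub_nonneg]
  refine le_trans (Finset.sum_nonpos fun n _ => ?_) (priorityProb_nonneg S K m)
  refine mul_nonpos_of_nonneg_of_nonpos (div_nonneg (S n).nu_nonneg (S n).zeta_pos.le)
    ((min_le_right _ _).trans (mul_nonpos_of_nonpos_of_nonneg ?_ (by linarith [(S n).omega_pos])))
  linarith [priorityProb_le_one S K n.castSucc]

theorem exists_isGreatest_admissibleMultipliers {r : ℝ} (hr : 0 < r)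
    (hr' : r ≤ ∑ n, (S n).changeRate) : ∃ θ, IsGreatest (admissibleMultipliers S K r) θ := by
  set P := {θ | r ≤ ∑ n ∈ outerSet S K θ, (S n).changeRate} with hP
  have hne : P.Nonempty := ⟨-1, by simpa [hP, outerSet_neg_one] using hr'⟩
  have hbdd : BddAbove P := by
    refine ⟨∑ n, sourceThreshold S K n, fun θ hθ => ?_⟩
    obtain ⟨n, hn⟩ : (outerSet S K θ).Nonempty := by
      by_contra hc
      rw [hP, Set.mem_ofPred_eq, Finset.not_nonempty_iff_eq_empty.1 hc, Finset.sum_empty] at hθ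
      linarith
    simp only [outerSet, Finset.mem_filter] at hn
    exact hn.2.1.trans (Finset.single_le_sum (fun n _ => sourceThreshold_nonneg S K n)
      (Finset.mem_univ n))
  have hmem : sSup P ∈ P := (isClosed_setOf_le_outer_rate S K r).csSup_mem hne hbdd
  refine ⟨sSup P, ⟨?_, hmem⟩, fun θ hθ => le_csSup hbdd hθ.2⟩
  -- A price slightly above the supremum has an outer rate less than `r`.
  obtain ⟨θ', hsub, hlt⟩ := (((eventually_innerSet_subset_outerSet S K (sSup P)).filter_mono
    nhdsWithin_le_nhds).and (self_mem_nhdsWithin : Set.Ioi (sSup P) ∈ nhdsWithin (sSup P) _)).exists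
  have h1 : ¬ r ≤ ∑ n ∈ outerSet S K θ', (S n).changeRate := fun h =>
    absurd (le_csSup hbdd h) (not_le.2 hlt)
  exact (Finset.sum_le_sum_of_subset_of_nonneg hsub
    fun n _ _ => (S n).changeRate_nonneg).trans (not_le.1 h1).le

/-! ### Switching times -/

variable {S K}

theorem partialTime_mem_Icc {T : ℕ} {r θ : ℝ} (h : θ ∈ admissibleMultipliers S K r) :
    0 ≤ partialTime S K T r θ ∧ partialTime S K T r θ ≤ T := by
  have hs := Finset.sum_sdiff (f := fun n => (S n).changeRate) (innerSet_subset_outerSet S K θ)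
  have hD : 0 ≤ ∑ n ∈ outerSet S K θ \ innerSet S K θ, (S n).changeRate :=
    Finset.sum_nonneg fun n _ => (S n).changeRate_nonneg
  have h1 := h.1
  have h2 := h.2
  refine ⟨mul_nonneg (Nat.cast_nonneg T) (div_nonneg (by linarith) hD), ?_⟩
  exact mul_le_of_le_one_right (Nat.cast_nonneg T) (div_le_one_of_le₀ (by linarith) hD)

theorem switchingTime_le {T : ℕ} {r θ : ℝ} (h : θ ∈ admissibleMultipliers S K r) (n : Fin N) :
    switchingTime S K T r θ n ≤ T := by
  unfold switchingTime
  split_ifs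
  · exact le_rfl
  · exact Nat.floor_le_of_le (partialTime_mem_Icc h).2
  · exact Nat.zero_le _

/-- Without the rounding, the switching times would spend the rate exactly. -/
theorem partialTime_mul_rate {T : ℕ} {r θ : ℝ} (h : θ ∈ admissibleMultipliers S K r) :
    partialTime S K T r θ * ∑ n ∈ outerSet S K θ \ innerSet S K θ, (S n).changeRate =
      T * (r - ∑ n ∈ innerSet S K θ, (S n).changeRate) := by
  rcases eq_or_ne (∑ n ∈ outerSet S K θ \ innerSet S K θ, (S n).changeRate) 0 with h0 | h0
  · have hs := Finset.sum_sdiff (f := fun n => (S n).changeRate) (innerSet_subset_outerSet S K θ)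
    have h1 := h.1
    have h2 := h.2
    have : r - ∑ n ∈ innerSet S K θ, (S n).changeRate = 0 := by linarith
    rw [h0, this]
    ring
  · rw [partialTime, mul_assoc, div_mul_cancel₀ _ h0]

theorem sum_switchingTime_mul (T : ℕ) (r θ : ℝ) :
    ∑ n, (switchingTime S K T r θ n : ℝ) * (S n).changeRate =
      T * ∑ n ∈ innerSet S K θ, (S n).changeRate +
        ⌊partialTime S K T r θ⌋₊ * ∑ n ∈ outerSet S K θ \ innerSet S K θ, (S n).changeRate := by
  have hsub := innerSet_subset_outerSet S K θ
  have h1 : ∑ n ∈ outerSet S K θ, (switchingTime S K T r θ n : ℝ) * (S n).changeRate =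
      ∑ n, (switchingTime S K T r θ n : ℝ) * (S n).changeRate := by
    refine Finset.sum_subset (Finset.subset_univ _) fun n _ hn => ?_
    rw [switchingTime, if_neg fun h => hn (hsub h), if_neg hn]
    simp
  rw [← h1, ← Finset.sum_sdiff hsub, add_comm, Finset.mul_sum, Finset.mul_sum]
  congr 1
  · refine Finset.sum_congr rfl fun n hn => ?_
    rw [switchingTime, if_pos hn]
  · refine Finset.sum_congr rfl fun n hn => ?_
    rw [Finset.mem_sdiff] at hn
    rw [switchingTime, if_neg hn.2, if_pos hn.1]

theorem sum_switchingTime_mul_le {T : ℕ} {r θ : ℝ} (h : θ ∈ admissibleMultipliers S K r) :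
    ∑ n, (switchingTime S K T r θ n : ℝ) * (S n).changeRate ≤ r * T := by
  have hD : 0 ≤ ∑ n ∈ outerSet S K θ \ innerSet S K θ, (S n).changeRate :=
    Finset.sum_nonneg fun n _ => (S n).changeRate_nonneg
  have h1 := mul_le_mul_of_nonneg_right (Nat.floor_le (partialTime_mem_Icc (T := T) h).1) hD
  rw [partialTime_mul_rate h] at h1
  rw [sum_switchingTime_mul]
  linarith

theorem le_sum_switchingTime_mul {T : ℕ} {r θ : ℝ} (h : θ ∈ admissibleMultipliers S K r) :
    r * T - N ≤ ∑ n, (switchingTime S K T r θ n : ℝ) * (S n).changeRate := by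
  have hD : 0 ≤ ∑ n ∈ outerSet S K θ \ innerSet S K θ, (S n).changeRate :=
    Finset.sum_nonneg fun n _ => (S n).changeRate_nonneg
  have hDN : ∑ n ∈ outerSet S K θ \ innerSet S K θ, (S n).changeRate ≤ N := by
    calc _ ≤ ∑ n, (S n).changeRate := Finset.sum_le_sum_of_subset_of_nonneg
            (Finset.subset_univ _) fun n _ _ => (S n).changeRate_nonneg
      _ ≤ ∑ _n : Fin N, (1 : ℝ) := Finset.sum_le_sum fun n _ => (S n).changeRate_le_one
      _ = N := by simp
  have h1 := mul_le_mul_of_nonneg_right (Nat.lt_floor_add_one (partialTime S K T r θ)).le hD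
  rw [partialTime_mul_rate h] at h1
  rw [sum_switchingTime_mul]
  linarith

theorem switching_updates_le {T : ℕ} {r θ : ℝ} (h : θ ∈ admissibleMultipliers S K r) :
    ∑ t ∈ Finset.Icc 1 T, ∑ n,
      (S n).updateProb ((S n).switchingPolicy (switchingTime S K T r θ n)) t ≤ r * T + 3 * N := by
  rw [Finset.sum_comm]
  calc _ ≤ ∑ n, ((switchingTime S K T r θ n : ℝ) * (S n).changeRate + 3) :=
        Finset.sum_le_sum fun n _ => (S n).switching_updateProb_sum_le _ _
    _ = ∑ n, (switchingTime S K T r θ n : ℝ) * (S n).changeRate + 3 * N := by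
        rw [Finset.sum_add_distrib]
        simp [mul_comm]
    _ ≤ _ := by linarith [sum_switchingTime_mul_le (T := T) h]

/-! ### Lagrangian bounds for the network -/

theorem errorApprox_le (U : Fin N → UpdatePolicy) (t : ℕ) (m : Fin (N + 1)) :
    errorApprox S K U t ≤ priorityProb S K m + ∑ n : Fin N, (if n.castSucc < m then 1 else 0) *
      (priorityProb S K n.castSucc * (S n).errorProb (U n) t) := by
  refine (Finset.inf'_le _ (Finset.mem_univ m)).trans (le_of_eq ?_)
  rw [Finset.sum_filter]
  simp

theorem exists_errorApprox_eq (U : Fin N → UpdatePolicy) (t : ℕ) :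
    ∃ m : Fin (N + 1), errorApprox S K U t = priorityProb S K m +
      ∑ n : Fin N, (if n.castSucc < m then 1 else 0) *
        (priorityProb S K n.castSucc * (S n).errorProb (U n) t) := by
  obtain ⟨m, -, hm⟩ := Finset.exists_mem_eq_inf' Finset.univ_nonempty fun m : Fin (N + 1) =>
    priorityProb S K m +
      ∑ n : Fin N with n.castSucc < m, priorityProb S K n.castSucc * (S n).errorProb (U n) t
  refine ⟨m, hm.trans ?_⟩
  rw [Finset.sum_filter]
  simp

theorem headCost_eq_sum (θ : ℝ) (m : Fin (N + 1)) :
    headCost S K θ m = priorityProb S K m + ∑ n : Fin N, (if n.castSucc < m then 1 else 0) *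
      (S n).steadyCost (priorityProb S K n.castSucc) θ := by
  rw [headCost, Finset.sum_filter]
  simp

theorem network_lagrangian_lower {δ θ : ℝ} (hδ : 0 < δ) (hS : ∀ n, δ ≤ (S n).zeta) (hθ : 0 ≤ θ)
    (hθδ : θ ≤ 1 / δ) {m : Fin (N + 1)} (hm : m ∈ tailArgmin S K θ) (T : ℕ)
    (U : Fin N → UpdatePolicy) :
    T * headCost S K θ m - (4 / δ + 2 / δ ^ 2) * N ≤
      ∑ t ∈ Finset.Icc 1 T, errorApprox S K U t +
        θ * ∑ t ∈ Finset.Icc 1 T, ∑ n, (S n).updateProb (U n) t := by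
  choose M hM using fun t => exists_errorApprox_eq (S := S) (K := K) U t
  have h1 : T * headCost S K θ m ≤ ∑ t ∈ Finset.Icc 1 T, headCost S K θ (M t) := by
    have := Finset.card_nsmul_le_sum (Finset.Icc 1 T) (fun t => headCost S K θ (M t))
      (headCost S K θ m) fun t _ => headCost_le S K hm (M t)
    simpa using this
  have h2 := Finset.sum_le_sum fun n (_ : n ∈ (Finset.univ : Finset (Fin N))) =>
    (S n).lagrangian_lower (U n) hδ (hS n) (priorityProb_nonneg S K n.castSucc) hθ hθδ
      (fun t => if n.castSucc < M t then 1 else 0)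
      (fun t => by by_cases h : n.castSucc < M t <;> simp [h]) T
  rw [Finset.sum_sub_distrib, Finset.sum_comm] at h2
  simp only [Finset.sum_add_distrib, ← Finset.mul_sum] at h2
  rw [Finset.sum_comm (γ := Fin N), Finset.sum_comm (s := Finset.univ) (t := Finset.Icc 1 T)
    (f := fun n t => (S n).updateProb (U n) t)] at h2
  simp only [hM, headCost_eq_sum] at h1 ⊢
  rw [Finset.sum_add_distrib] at h1 ⊢
  simp at h2
  simp at h1 ⊢
  linarith

/-- The switching policy attains the Lagrangian lower bound: the greatest minimizer is charged until the
common switching time of the sources of the outer set, and the least one afterwards. -/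
theorem switching_lagrangian_upper {T : ℕ} {r θ : ℝ} (h : θ ∈ admissibleMultipliers S K r)
    {m : Fin (N + 1)} (hm : m ∈ tailArgmin S K θ) :
    ∑ t ∈ Finset.Icc 1 T,
        errorApprox S K (fun n => (S n).switchingPolicy (switchingTime S K T r θ n)) t +
      θ * ∑ n, (switchingTime S K T r θ n : ℝ) * (S n).changeRate ≤ T * headCost S K θ m + N := by
  obtain ⟨lo, hlo, hlo'⟩ := exists_least_tailArgmin S K θ
  obtain ⟨hi, hhi, hhi'⟩ := exists_greatest_tailArgmin S K θ
  have hinner : ∀ n, n ∈ innerSet S K θ ↔ θ < sourceThreshold S K n ∧ n.castSucc < lo := by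
    intro n
    simp only [innerSet, Finset.mem_filter, Finset.mem_univ, true_and]
    exact and_congr_right fun _ => ⟨fun h => h lo hlo, fun h m hm => h.trans_le (hlo' m hm)⟩
  have houter : ∀ n, n ∈ outerSet S K θ ↔ θ ≤ sourceThreshold S K n ∧ n.castSucc < hi := by
    intro n
    simp only [outerSet, Finset.mem_filter, Finset.mem_univ, true_and]
    exact and_congr_right fun _ =>
      ⟨fun ⟨m, hm, h⟩ => h.trans_le (hhi' m hm), fun h => ⟨hi, hhi, h⟩⟩
  have hlohi : lo ≤ hi := hlo' hi hhi
  set Q := ⌊partialTime S K T r θ⌋₊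
  set M : ℕ → Fin (N + 1) := fun t => if t ≤ Q then hi else lo with hMdef
  have hM : ∀ t, M t ∈ tailArgmin S K θ := fun t => by
    simp only [hMdef]
    split_ifs
    exacts [hhi, hlo]
  have hhead : ∀ t, headCost S K θ (M t) = headCost S K θ m := fun t =>
    le_antisymm (headCost_le S K (hM t) m) (headCost_le S K hm _)
  have hpt : ∀ t ∈ Finset.Icc 1 T, ∀ n : Fin N,
      (if n.castSucc < M t then (1 : ℝ) else 0) * (priorityProb S K n.castSucc *
        (S n).errorProb ((S n).switchingPolicy (switchingTime S K T r θ n)) t) ≤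
      (if n.castSucc < M t then (1 : ℝ) else 0) * (S n).steadyCost (priorityProb S K n.castSucc) θ
        - θ * (S n).changeRate * (if t ≤ switchingTime S K T r θ n then 1 else 0)
        + if t = 1 then 1 else 0 := by
    intro t ht n
    obtain ⟨ht1, htT⟩ := Finset.mem_Icc.1 ht
    set τ := switchingTime S K T r θ n with hτ
    have hα0 := priorityProb_nonneg S K n.castSucc
    have hα1 := priorityProb_le_one S K n.castSucc
    have he := mul_le_mul_of_nonneg_left ((S n).switching_errorProb_le τ ht1) hα0
    have hone : priorityProb S K n.castSucc * (if t = 1 then 1 else 0) ≤ if t = 1 then 1 else 0 := by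
      split_ifs <;> linarith
    have hind : (0 : ℝ) ≤ if t = 1 then 1 else 0 := by split_ifs <;> norm_num
    rw [mul_add] at he
    -- Before its switching time the source counts, and updates are sent in both error states.
    have early : t ≤ τ → n.castSucc < M t → θ ≤ sourceThreshold S K n →
        (if n.castSucc < M t then (1 : ℝ) else 0) * (priorityProb S K n.castSucc *
          (S n).errorProb ((S n).switchingPolicy τ) t) ≤
        (if n.castSucc < M t then (1 : ℝ) else 0) *
            (S n).steadyCost (priorityProb S K n.castSucc) θ
          - θ * (S n).changeRate * (if t ≤ τ then 1 else 0) + if t = 1 then 1 else 0 := by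
      intro h1 h2 h3
      rw [if_pos h1] at he
      rw [if_pos h2, if_pos h1, steadyCost_of_le S K h3]
      linarith
    -- After it the source either does not count, or lies at or above its threshold.
    have late : τ < t → (n.castSucc < M t → sourceThreshold S K n ≤ θ) →
        (if n.castSucc < M t then (1 : ℝ) else 0) * (priorityProb S K n.castSucc *
          (S n).errorProb ((S n).switchingPolicy τ) t) ≤
        (if n.castSucc < M t then (1 : ℝ) else 0) *
            (S n).steadyCost (priorityProb S K n.castSucc) θ
          - θ * (S n).changeRate * (if t ≤ τ then 1 else 0) + if t = 1 then 1 else 0 := by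
      intro h1 h2
      rw [if_neg (not_le.2 h1)] at he ⊢
      by_cases h3 : n.castSucc < M t
      · rw [if_pos h3, steadyCost_of_ge S K (h2 h3)]
        linarith
      · rw [if_neg h3]
        linarith
    by_cases hA : n ∈ innerSet S K θ
    · have hAn := (hinner n).1 hA
      refine early (by rw [hτ, switchingTime, if_pos hA]; exact htT) ?_ hAn.1.le
      simp only [hMdef]
      split_ifs
      exacts [hAn.2.trans_le hlohi, hAn.2]
    · by_cases hB : n ∈ outerSet S K θ
      · have hBn := (houter n).1 hB
        have hτQ : τ = Q := by rw [hτ, switchingTime, if_neg hA, if_pos hB]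
        by_cases htQ : t ≤ Q
        · exact early (hτQ ▸ htQ) (by simp only [hMdef, if_pos htQ]; exact hBn.2) hBn.1
        · refine late (by omega) fun hlt => ?_
          simp only [hMdef, if_neg htQ] at hlt
          exact not_lt.1 fun hc => hA ((hinner n).2 ⟨hc, hlt⟩)
      · have hτ0 : τ = 0 := by rw [hτ, switchingTime, if_neg hA, if_neg hB]
        refine late (by omega) fun hlt => ?_
        have : n.castSucc < hi := by
          simp only [hMdef] at hlt
          split_ifs at hlt
          exacts [hlt, hlt.trans_le hlohi]
        exact (not_le.1 fun hc => hB ((houter n).2 ⟨hc, this⟩)).le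
  have hslot : ∀ t ∈ Finset.Icc 1 T,
      errorApprox S K (fun n => (S n).switchingPolicy (switchingTime S K T r θ n)) t ≤
        headCost S K θ m -
          ∑ n, θ * (S n).changeRate * (if t ≤ switchingTime S K T r θ n then 1 else 0) +
          N * (if t = 1 then 1 else 0) := by
    intro t ht
    refine (errorApprox_le _ t (M t)).trans ?_
    have h1 := Finset.sum_le_sum fun n (_ : n ∈ Finset.univ) => hpt t ht n
    rw [Finset.sum_add_distrib, Finset.sum_sub_distrib, Finset.sum_const] at h1
    rw [← hhead t, headCost_eq_sum]
    simp only [Finset.card_univ, Fintype.card_fin, nsmul_eq_mul] at h1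
    linarith
  have hsum := Finset.sum_le_sum hslot
  rw [Finset.sum_add_distrib, Finset.sum_sub_distrib, Finset.sum_comm, ← Finset.mul_sum] at hsum
  have hcount : ∀ n : Fin N, ∑ t ∈ Finset.Icc 1 T,
      θ * (S n).changeRate * (if t ≤ switchingTime S K T r θ n then 1 else 0) =
        θ * ((switchingTime S K T r θ n : ℝ) * (S n).changeRate) := by
    intro n
    have hle := switchingTime_le (T := T) h n
    have : (Finset.Icc 1 T).filter (fun t => t ≤ switchingTime S K T r θ n) =
        Finset.Icc 1 (switchingTime S K T r θ n) := by
      ext t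
      simp only [Finset.mem_filter, Finset.mem_Icc]
      omega
    rw [← Finset.mul_sum, Finset.sum_boole, this]
    simp
    ring
  simp only [hcount, ← Finset.mul_sum] at hsum
  have hfirst : ∑ t ∈ Finset.Icc 1 T, (if t = 1 then (1 : ℝ) else 0) ≤ 1 := by
    rw [Finset.sum_ite_eq']
    split_ifs <;> norm_num
  have hN := mul_le_mul_of_nonneg_left hfirst (Nat.cast_nonneg (α := ℝ) N)
  simp only [Finset.sum_const, Nat.card_Icc, Nat.add_sub_cancel, nsmul_eq_mul] at hsum
  linarith

/-! ### Negative multipliers -/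

theorem steadyCost_zero (n : Fin N) :
    (S n).steadyCost (priorityProb S K n.castSucc) 0 =
      priorityProb S K n.castSucc * (S n).changeRate := by
  rw [steadyCost_of_le S K (sourceThreshold_nonneg S K n), add_zero]

/-- The minimum for unconstrained updates bounds the error of every policy. -/
theorem headCost_zero_le_errorApprox {m : Fin (N + 1)} (hm : m ∈ tailArgmin S K 0)
    (U : Fin N → UpdatePolicy) {t : ℕ} (ht : 1 ≤ t) : headCost S K 0 m ≤ errorApprox S K U t := by
  obtain ⟨m', hm'⟩ := exists_errorApprox_eq (S := S) (K := K) U t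
  refine (headCost_le S K hm m').trans ?_
  rw [hm', headCost_eq_sum]
  refine add_le_add le_rfl (Finset.sum_le_sum fun n _ => ?_)
  rw [steadyCost_zero]
  refine mul_le_mul_of_nonneg_left (mul_le_mul_of_nonneg_left
    ((S n).changeRate_le_errorProb _ ht) (priorityProb_nonneg S K _)) ?_
  split_ifs <;> norm_num

/-- For a negative multiplier, every source that unconstrained updates keep lies in the inner set: the
tail cost increases faster, as `θ` decreases, for smaller `m`, so that its minimizers do not move to the
left of those at `0`. -/
theorem mem_innerSet_of_neg {θ : ℝ} (hθ : θ < 0) {m : Fin (N + 1)} (hm : m ∈ tailArgmin S K 0)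
    {n : Fin N} (hn : n.castSucc < m) : n ∈ innerSet S K θ := by
  simp only [innerSet, Finset.mem_filter, Finset.mem_univ, true_and]
  refine ⟨hθ.trans_le (sourceThreshold_nonneg S K n), fun m' hm' => ?_⟩
  refine hn.trans_le (not_lt.1 fun hlt => ?_)
  have h1 := headCost_le S K hm m'
  have h2 := headCost_le S K hm' m
  have hd : ∀ k, headCost S K θ k = headCost S K 0 k +
      θ * ∑ n : Fin N with n.castSucc < k, (S n).changeRate := by
    intro k
    rw [headCost, headCost, add_assoc, Finset.mul_sum, ← Finset.sum_add_distrib]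
    congr 1
    refine Finset.sum_congr rfl fun n _ => ?_
    rw [steadyCost_zero, steadyCost_of_le S K (hθ.le.trans (sourceThreshold_nonneg S K n))]
    ring
  have h3 : ∑ n : Fin N with n.castSucc < m', (S n).changeRate <
      ∑ n : Fin N with n.castSucc < m, (S n).changeRate := by
    have hne : m' ≠ Fin.last N := (hlt.trans_le (Fin.le_last m)).ne
    refine Finset.sum_lt_sum_of_subset (i := m'.castPred hne) ?_ ?_ ?_ (S _).changeRate_pos
      fun n _ _ => (S n).changeRate_nonneg
    · intro k hk
      simp only [Finset.mem_filter, Finset.mem_univ, true_and] at *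
      exact hk.trans hlt
    · simpa using hlt
    · simp
  rw [hd, hd] at h2
  have := mul_lt_mul_of_neg_left h3 hθ
  linarith

theorem switching_upper_of_neg {T : ℕ} {r θ : ℝ} (hθ : θ < 0) {m : Fin (N + 1)}
    (hm : m ∈ tailArgmin S K 0) :
    ∑ t ∈ Finset.Icc 1 T,
        errorApprox S K (fun n => (S n).switchingPolicy (switchingTime S K T r θ n)) t ≤
      T * headCost S K 0 m + N := by
  have hslot : ∀ t ∈ Finset.Icc 1 T,
      errorApprox S K (fun n => (S n).switchingPolicy (switchingTime S K T r θ n)) t ≤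
        headCost S K 0 m + N * (if t = 1 then 1 else 0) := by
    intro t ht
    obtain ⟨ht1, htT⟩ := Finset.mem_Icc.1 ht
    refine (errorApprox_le _ t m).trans ?_
    have h1 : ∀ n : Fin N, (if n.castSucc < m then (1 : ℝ) else 0) * (priorityProb S K n.castSucc *
        (S n).errorProb ((S n).switchingPolicy (switchingTime S K T r θ n)) t) ≤
        (if n.castSucc < m then (1 : ℝ) else 0) * (S n).steadyCost (priorityProb S K n.castSucc) 0 +
          if t = 1 then 1 else 0 := by
      intro n
      by_cases hn : n.castSucc < m
      · have hα0 := priorityProb_nonneg S K n.castSucc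
        have hα1 := priorityProb_le_one S K n.castSucc
        have hτ : switchingTime S K T r θ n = T := by
          rw [switchingTime, if_pos (mem_innerSet_of_neg hθ hm hn)]
        have he := mul_le_mul_of_nonneg_left ((S n).switching_errorProb_le T ht1) hα0
        have hone : priorityProb S K n.castSucc * (if t = 1 then 1 else 0) ≤
            if t = 1 then 1 else 0 := by
          split_ifs <;> linarith
        rw [if_pos htT, mul_add] at he
        rw [if_pos hn, hτ, steadyCost_zero]
        linarith
      · rw [if_neg hn]
        split_ifs <;> norm_num
    have h2 := Finset.sum_le_sum fun n (_ : n ∈ Finset.univ) => h1 n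
    rw [Finset.sum_add_distrib, Finset.sum_const] at h2
    simp only [Finset.card_univ, Fintype.card_fin, nsmul_eq_mul] at h2
    rw [headCost_eq_sum]
    linarith
  have hsum := Finset.sum_le_sum hslot
  have hfirst : ∑ t ∈ Finset.Icc 1 T, (if t = 1 then (1 : ℝ) else 0) ≤ 1 := by
    rw [Finset.sum_ite_eq']
    split_ifs <;> norm_num
  have hN := mul_le_mul_of_nonneg_left hfirst (Nat.cast_nonneg (α := ℝ) N)
  rw [Finset.sum_add_distrib, ← Finset.mul_sum] at hsum
  simp only [Finset.sum_const, Nat.card_Icc, Nat.add_sub_cancel, nsmul_eq_mul] at hsum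
  linarith

theorem multiplier_le {δ r θ : ℝ} (hδ : 0 < δ) (hS : ∀ n, δ ≤ (S n).zeta) (hr : 0 < r)
    (h : θ ∈ admissibleMultipliers S K r) : θ ≤ 1 / δ := by
  obtain ⟨n, hn⟩ : (outerSet S K θ).Nonempty := by
    by_contra hc
    have h2 := h.2
    rw [Finset.not_nonempty_iff_eq_empty.1 hc, Finset.sum_empty] at h2
    linarith
  simp only [outerSet, Finset.mem_filter] at hn
  exact hn.2.1.trans (sourceThreshold_le S K hδ n (hS n))

/-- The switching policy is optimal up to an error proportional to the number of sources. -/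
theorem switching_optimal {δ r θ : ℝ} (hδ : 0 < δ) (hS : ∀ n, δ ≤ (S n).zeta) (hr : 0 < r)
    (h : θ ∈ admissibleMultipliers S K r) {T : ℕ} {U : Fin N → UpdatePolicy}
    (hU : ∑ t ∈ Finset.Icc 1 T, ∑ n, (S n).updateProb (U n) t ≤ r * T) :
    ∑ t ∈ Finset.Icc 1 T,
        errorApprox S K (fun n => (S n).switchingPolicy (switchingTime S K T r θ n)) t ≤
      ∑ t ∈ Finset.Icc 1 T, errorApprox S K U t + (1 + 5 / δ + 2 / δ ^ 2) * N := by
  have hN : (0 : ℝ) ≤ N := Nat.cast_nonneg N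
  rcases le_or_gt 0 θ with hθ | hθ
  · obtain ⟨m, hm⟩ := tailArgmin_nonempty S K θ
    have hθδ := multiplier_le hδ hS hr h
    have h1 := network_lagrangian_lower hδ hS hθ hθδ hm T U
    have h2 := switching_lagrangian_upper (T := T) h hm
    have h3 := mul_le_mul_of_nonneg_left (le_sum_switchingTime_mul (T := T) h) hθ
    have h4 := mul_le_mul_of_nonneg_left hU hθ
    have h5 := mul_le_mul_of_nonneg_right hθδ hN
    have e : (5 : ℝ) / δ = 4 / δ + 1 / δ := by ring
    rw [e]
    linarith
  · obtain ⟨m, hm⟩ := tailArgmin_nonempty S K 0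
    have h1 := switching_upper_of_neg (T := T) (r := r) hθ hm
    have h2 := Finset.card_nsmul_le_sum (Finset.Icc 1 T) (fun t => errorApprox S K U t) _
      fun t ht => headCost_zero_le_errorApprox hm U (Finset.mem_Icc.1 ht).1
    simp only [Nat.card_Icc, Nat.add_sub_cancel, nsmul_eq_mul] at h2
    have h3 : 0 ≤ (5 / δ + 2 / δ ^ 2) * N := by positivity
    linarith

end Network

theorem theorem3 (δ : ℝ) (hδ : 0 < δ) :
    ∃ C : ℝ, ∀ (N K T : ℕ) (S : Fin N → RemoteSource) (r : ℝ),
      1 ≤ T → (∀ n, δ ≤ (S n).zeta) → 0 < r → r ≤ ∑ n, (S n).changeRate →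
      ∃ θ : ℝ, IsGreatest (admissibleMultipliers S K r) θ ∧
        (∀ U : Fin N → UpdatePolicy, updateRate S T U ≤ r →
          avgErrorApprox S K T (fun n => (S n).switchingPolicy (switchingTime S K T r θ n))
            ≤ avgErrorApprox S K T U + C * ((N : ℝ) / T)) ∧
        updateRate S T (fun n => (S n).switchingPolicy (switchingTime S K T r θ n))
          ≤ r + C * ((N : ℝ) / T) := by
  refine ⟨3 + 5 / δ + 2 / δ ^ 2, fun N K T S r hT hS hr hr' => ?_⟩
  obtain ⟨θ, hθ⟩ := exists_isGreatest_admissibleMultipliers S K hr hr'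
  have hT0 : (0 : ℝ) < T := by exact_mod_cast hT
  have hN : (0 : ℝ) ≤ N := Nat.cast_nonneg N
  have hc : 0 ≤ (5 / δ + 2 / δ ^ 2) * N := by positivity
  refine ⟨θ, hθ, fun U hU => ?_, ?_⟩
  · rw [updateRate, one_div_mul_eq_div, div_le_iff₀ hT0] at hU
    have h1 := switching_optimal hδ hS hr hθ.1 hU
    rw [avgErrorApprox, avgErrorApprox, one_div_mul_eq_div, one_div_mul_eq_div, ← mul_div_assoc,
      ← add_div]
    refine div_le_div_of_nonneg_right ?_ hT0.le
    linarith
  · have h1 := switching_updates_le (T := T) hθ.1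
    rw [updateRate, one_div_mul_eq_div, div_le_iff₀ hT0, add_mul, mul_assoc _ _ (T : ℝ),
      div_mul_cancel₀ _ hT0.ne']
    linarith
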